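/- **Setting.** Let $\mathbb N^*=\{0,0^*,1,1^*,\dots\}$ with the order $0<0^*<1<1^*<\cdots$; write $\mathrm{succ}$ for the successor in this order. For $x,y\in\mathbb N$ put $x\oplus y=x+y$, $x^*\oplus y=x\oplus y^*=(x+y)^*$, $x^*\oplus y^*=x+y+1$, and $x\ominus y=x-y$, $x^*\ominus y=(x-y)^*$, $x^*\ominus y^*=x-y$, $x\ominus y^*=(x-y-1)^*$. A budget $B^*$ means a budget of $B$ together with the tie-breaking advantage. For $k\in\mathbb N$ let $[k]=\{0,0^*,\dots,k,k^*\}$, so $|[k]|=2(k+1)$. An energy discrete-bidding game $\mathcal G=\langle V,E,k,w\rangle$ consists of a finite directed graph $(V,E)$ in which every vertex $v$ has a non-empty set $N(v)$ of out-neighbors, a total budget $k\in\mathbb N$, and weights $w:E\to\mathbb Z$; let $W$ be the largest absolute weight. At a configuration $\langle v,B\rangle\in V\times[k]$ the token is on $v$, Preserver has budget $B$ and Consumer has budget $k^*\ominus B$. Both players simultaneously choose a legal bid and a vertex of $N(v)$; a bid $b\in\mathbb N^*$ is legal for a player with budget $C$ if $b\le C$ and, when $b\in\mathbb N^*\setminus\mathbb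 N$, the player holds the advantage. The higher bidder wins the bidding, and if the bids are equal the player without the advantage wins it. If Preserver wins with $\langle b,u\rangle$, the next configuration is $\langle u,B\ominus b\rangle$; if Consumer wins with $\langle b,u\rangle$, it is $\langle u,B\oplus b\rangle$. (Pure) strategies choose a legal action as a function of the finite sequence of configurations visited so far. For $M\in\mathbb Z$, Consumer $M$-wins a play that visits the vertices $v_0,v_1,\dots$ if $M+\sum_{j<m}w(v_j,v_{j+1})<0$ for some $m\ge 0$, and otherwise Preserver $M$-wins it. A player $M$-wins from a configuration if they have a strategy with which they $M$-win against every strategy of the opponent. An *energy threshold function* is a function $\mathrm{energy}:V\times[k]\to\mathbb N\cup\{\infty\}$ such that for every $\langle v,B\rangle$: if $\mathrm{energy}(v,B)=M\in\mathbb N$, then Preserver $M$-wins and Consumer $(M-1)$-wins from $\langle v,B\rangle$; if $\mathrm{energy}(v,B)=\infty$, then Consumer $M$-wins from $\langle v,B\rangle$ for every $M\in\mathbb N$. For $f:V\times[k]\to\mathbb N\cup\{\infty\}$ let $O(f)(v,B)$ be the minimum, over the legal bids $b$ of Preserver at $\langle v,B\rangle$, of the larger of $$\min_{u\in N(v)}\max\{f(u,B\ominus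 b)-w(v,u),0\}\quad\text{and}\quad \max_{u\in N(v)}\max\{f(u,B\oplus t)-w(v,u),0\},$$ where $t=b$ if $B\in\mathbb N^*\setminus\mathbb N$ and $b\in\mathbb N$, and $t=\mathrm{succ}(b)$ otherwise, and where the second expression is omitted if $B\oplus t>k^*$. Let $\mathrm{trim}(f)$ be $f$ with all values larger than $|V|\cdot|[k]|\cdot W$ replaced by $\infty$. Put $\mu_0\equiv 0$, $\mu_{n+1}=O(\mu_n)$, and $\tilde\mu_n=\mathrm{trim}(\mu_n)$. Also put $\alpha_0\equiv0$ and $\alpha_{i+1}=\mathrm{trim}(O(\alpha_i))$. **Theorem.** In every energy discrete-bidding game there is a function $\mu:V\times[k]\to\mathbb N\cup\{\infty\}$ such that: 1. $\tilde\mu_n=\mu$ for all sufficiently large $n$; 2. $\alpha_{i+1}=\alpha_i$ for some $i$, and whenever $\alpha_{i+1}=\alpha_i$, this function is $\mu$; 3. $\mu$ is an energy threshold function, and it is the only one; that is, the energy threshold function exists and equals $\mu$; 4. for every configuration $\langle v,B\rangle$ and every $M\in\mathbb N$, Preserver $M$-wins from $\langle v,B\rangle$ if $M\ge\mu(v,B)$,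 and Consumer $M$-wins from $\langle v,B\rangle$ if $M<\mu(v,B)$. In particular, energy bidding games are determined: from every configuration and for every initial energy $M\in\mathbb N$, one of the two players $M$-wins. -/

import Mathlib

/-! ### Concurrent games -/

/-- The two players. In an energy game, Player 1 is Preserver and Player 2 is Consumer. -/
inductive Player
  | one
  | two

/-- The arena of a concurrent game with actions `A` and states `Q`. The value of `δ` matters only
at actions that are allowed. -/
structure ConcurrentArena (A Q : Type*) where
  allowed : Q → Player → Set A
  allowed_nonempty : ∀ q i, (allowed q i).Nonempty
  δ : Q → A → A → Q

namespace ConcurrentArena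

variable {A Q : Type*}

/-- A (pure) strategy of player `i`: `σ h q` is the action taken at the current state `q` after the
states in `h` (in chronological order) have been visited before. Only allowed actions are taken. -/
def Strategy (G : ConcurrentArena A Q) (i : Player) : Type _ :=
  {σ : List Q → Q → A // ∀ h q, σ h q ∈ G.allowed q i}

/-- The past states and the current state after `n` turns. -/
def run (G : ConcurrentArena A Q) (q₀ : Q) (σ : G.Strategy .one) (τ : G.Strategy .two) :
    ℕ → List Q × Q
  | 0 => ([], q₀)
  | n + 1 =>
    let p := run G q₀ σ τ n
    (p.1 ++ [p.2], G.δ p.2 (σ.1 p.1 p.2) (τ.1 p.1 p.2))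

/-- The infinite play from `q₀` when Player 1 follows `σ` and Player 2 follows `τ`. -/
def play (G : ConcurrentArena A Q) (q₀ : Q) (σ : G.Strategy .one) (τ : G.Strategy .two)
    (n : ℕ) : Q :=
  (G.run q₀ σ τ n).2

end ConcurrentArena

/-! ### Budgets with an advantage -/

/-- The set `ℕ* = {0, 0*, 1, 1*, …}`: `⟨x, false⟩` is `x` and `⟨x, true⟩` is `x*`. -/
@[ext]
structure StarNat where
  amount : ℕ
  adv : Bool

namespace StarNat

/-- The position in the order `0 ≺ 0* ≺ 1 ≺ 1* ≺ …`. -/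
def code (B : StarNat) : ℕ := 2 * B.amount + B.adv.toNat

theorem code_injective : Function.Injective code := by
  rintro ⟨x, a⟩ ⟨y, b⟩ h
  cases a <;> cases b <;> simp [code] at h ⊢ <;> omega

instance : LinearOrder StarNat := LinearOrder.lift' code code_injective

/-- The successor in the order `0 ≺ 0* ≺ 1 ≺ 1* ≺ …`. -/
def succ : StarNat → StarNat
  | ⟨x, false⟩ => ⟨x, true⟩
  | ⟨x, true⟩ => ⟨x + 1, false⟩

/-- The operator `⊕`. -/
def oplus : StarNat → StarNat → StarNat
  | ⟨x, false⟩, ⟨y, false⟩ => ⟨x + y, false⟩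
  | ⟨x, true⟩, ⟨y, false⟩ => ⟨x + y, true⟩
  | ⟨x, false⟩, ⟨y, true⟩ => ⟨x + y, true⟩
  | ⟨x, true⟩, ⟨y, true⟩ => ⟨x + y + 1, false⟩

/-- The operator `⊖` (used only when the second argument is at most the first). -/
def ominus : StarNat → StarNat → StarNat
  | ⟨x, true⟩, ⟨y, false⟩ => ⟨x - y, true⟩
  | ⟨x, true⟩, ⟨y, true⟩ => ⟨x - y, false⟩
  | ⟨x, false⟩, ⟨y, false⟩ => ⟨x - y, false⟩
  | ⟨x, false⟩, ⟨y, true⟩ => ⟨x - y - 1, true⟩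

/-- The legal bids of a player whose budget is `B`: bids within the budget, where the advantage can
only be used by a player who holds it. -/
def legalBids (B : StarNat) : Set StarNat :=
  {b | b ≤ B ∧ (b.adv = true → B.adv = true)}

/-- The minimal bid of Player 2 that wins against a bid `b` of Player 1, whose budget is `B`. -/
def trump (B b : StarNat) : StarNat :=
  if B.adv = true ∧ b.adv = false then b else b.succ

end StarNat

/-- The set `[k] = {0, 0*, 1, 1*, …, k, k*}`. -/
def Budget (k : ℕ) : Type := {B : StarNat // B ≤ ⟨k, true⟩}

/-- An element of `ℕ*` as an element of `[k]`; the minimum has no effect on elements of `[k]`. -/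
def Budget.of (k : ℕ) (B : StarNat) : Budget k :=
  ⟨min B ⟨k, true⟩, min_le_right _ _⟩

/-! ### Energy bidding games -/

/-- An energy bidding game `⟨V, E, k, w⟩`: every vertex has a neighbor, `k` is the total budget, and
`w v u` is the weight of the edge from `v` to `u` (irrelevant if there is no such edge). -/
structure EnergyBiddingGame (V : Type*) where
  edge : V → V → Prop
  exists_edge : ∀ v, ∃ u, edge v u
  k : ℕ
  w : V → V → ℤ

namespace EnergyBiddingGame

variable {V : Type*} (G : EnergyBiddingGame V)

/-- The neighbors of a vertex. -/
def nbr (v : V) : Set V := {u | G.edge v u}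

/-- The largest absolute value of a weight of an edge. -/
noncomputable def W [Fintype V] : ℕ :=
  open Classical in
  (Finset.univ.filter fun e : V × V => G.edge e.1 e.2).sup fun e => (G.w e.1 e.2).natAbs

/-- A configuration `⟨v, B⟩`: the token is on `v`, the budget of Player 1 is `B`, and that of
Player 2 is `k* ⊖ B`. -/
abbrev Config : Type _ := V × Budget G.k

/-- An action `⟨b, u⟩`: bid `b`, and move to `u` upon winning the bidding. -/
abbrev Action : Type _ := Budget G.k × V

/-- The budget of each player at a configuration. -/
def budgetOf (c : G.Config) : Player → StarNat
  | .one => c.2.1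
  | .two => StarNat.ominus ⟨G.k, true⟩ c.2.1

/-- Player 1 wins the bidding if her bid is higher, or if the bids are equal and she does not hold
the advantage (equal legal bids mean that the player with the advantage did not use it). -/
def FirstWinsBid (c : G.Config) (b₁ b₂ : StarNat) : Prop :=
  b₂ < b₁ ∨ (b₁ = b₂ ∧ c.2.1.adv = false)

/-- The concurrent game that corresponds to the bidding game. -/
noncomputable def arena : ConcurrentArena G.Action G.Config where
  allowed c i := {a | a.1.1 ∈ (G.budgetOf c i).legalBids ∧ a.2 ∈ G.nbr c.1}
  allowed_nonempty c i := by
    obtain ⟨u, hu⟩ := G.exists_edge c.1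
    refine ⟨⟨⟨⟨0, false⟩, ?_⟩, u⟩, ⟨?_, ?_⟩, hu⟩
    · exact Nat.zero_le _
    · exact Nat.zero_le _
    · intro h
      cases h
  δ c a₁ a₂ :=
    open Classical in
    if G.FirstWinsBid c a₁.1.1 a₂.1.1 then
      (a₁.2, Budget.of G.k (c.2.1.ominus a₁.1.1))
    else
      (a₂.2, Budget.of G.k (c.2.1.oplus a₂.1.1))

/-- The path in the graph that two strategies give rise to. -/
noncomputable def path (c : G.Config) (σ : G.arena.Strategy .one) (τ : G.arena.Strategy .two)
    (n : ℕ) : V :=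
  (G.arena.play c σ τ n).1

/-- The sum of the weights traversed by the prefix of length `m` of a path. -/
def sumOfWeights (π : ℕ → V) (m : ℕ) : ℤ :=
  ∑ j ∈ Finset.range m, G.w (π j) (π (j + 1))

/-- Preserver `M`-wins a path. -/
def PresWinsPath (M : ℤ) (π : ℕ → V) : Prop := ∀ m, 0 ≤ M + G.sumOfWeights π m

/-- Consumer `M`-wins a path. -/
def ConsWinsPath (M : ℤ) (π : ℕ → V) : Prop := ∃ m, M + G.sumOfWeights π m < 0

/-- Preserver `M`-wins from a configuration. -/
def PresWins (M : ℤ) (c : G.Config) : Prop :=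
  ∃ σ : G.arena.Strategy .one, ∀ τ : G.arena.Strategy .two, G.PresWinsPath M (G.path c σ τ)

/-- Consumer `M`-wins from a configuration. -/
def ConsWins (M : ℤ) (c : G.Config) : Prop :=
  ∃ τ : G.arena.Strategy .two, ∀ σ : G.arena.Strategy .one, G.ConsWinsPath M (G.path c σ τ)

/-- `e` is an energy threshold function of the game. -/
def IsEnergyThreshold (e : V → Budget G.k → ℕ∞) : Prop :=
  ∀ v B,
    (∀ M : ℕ, e v B = M → G.PresWins M (v, B) ∧ G.ConsWins ((M : ℤ) - 1) (v, B)) ∧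
    (e v B = ⊤ → ∀ M : ℕ, G.ConsWins M (v, B))

/-- The game is determined: from every configuration and with every initial energy, one of the
players has a winning strategy. -/
def Determined : Prop :=
  ∀ (c : G.Config) (M : ℕ), G.PresWins M c ∨ G.ConsWins M c

/-! ### Value iteration -/

/-- `max {x - w, 0}`, where `∞ - w = ∞`. -/
def deduct : ℕ∞ → ℤ → ℕ∞
  | ⊤, _ => ⊤
  | (x : ℕ), w => ((max ((x : ℤ) - w) 0).toNat : ℕ)

/-- The energy needed if Preserver bids `b` and wins the bidding. -/
noncomputable def eWin (f : V → Budget G.k → ℕ∞) (v : V) (B b : StarNat) : ℕ∞ :=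
  ⨅ u ∈ G.nbr v, deduct (f u (Budget.of G.k (B.ominus b))) (G.w v u)

/-- The energy needed if Preserver bids `b` and Consumer wins by the bid `trump B b`. -/
noncomputable def eLose (f : V → Budget G.k → ℕ∞) (v : V) (B b : StarNat) : ℕ∞ :=
  ⨆ u ∈ G.nbr v, deduct (f u (Budget.of G.k (B.oplus (B.trump b)))) (G.w v u)

/-- The energy needed if Preserver bids `b`. Consumer can win the bidding only if
`B ⊕ trump B b ≤ k*`. -/
noncomputable def eNext (f : V → Budget G.k → ℕ∞) (v : V) (B b : StarNat) : ℕ∞ :=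
  if B.oplus (B.trump b) ≤ ⟨G.k, true⟩ then max (G.eWin f v B b) (G.eLose f v B b)
  else G.eWin f v B b

/-- One step of value iteration. -/
noncomputable def step (f : V → Budget G.k → ℕ∞) (v : V) (B : Budget G.k) : ℕ∞ :=
  ⨅ b ∈ B.1.legalBids, G.eNext f v B.1 b

/-- The functions `μ_n`. -/
noncomputable def mu : ℕ → V → Budget G.k → ℕ∞
  | 0 => fun _ _ => 0
  | n + 1 => G.step (mu n)

/-- Trimming: values above `|V| · |[k]| · W` are replaced by `∞`. Here `|[k]| = 2 (k + 1)`, so that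
`|V| · |[k]|` is the number of configurations. -/
noncomputable def trim [Fintype V] (f : V → Budget G.k → ℕ∞) (v : V) (B : Budget G.k) : ℕ∞ :=
  if f v B ≤ ((Fintype.card V * (2 * (G.k + 1)) * G.W : ℕ) : ℕ∞) then f v B else ⊤

/-- The trimmed functions: `μ_n` with values above the bound replaced by `∞`. -/
noncomputable def trimmedMu [Fintype V] (n : ℕ) : V → Budget G.k → ℕ∞ := G.trim (G.mu n)

/-- The iteration as an algorithm runs it: values are trimmed after every step, and the next step
starts from the trimmed function. -/
noncomputable def algMu [Fintype V] : ℕ → V → Budget G.k → ℕ∞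
  | 0 => fun _ _ => 0
  | n + 1 => G.trim (G.step (algMu n))

end EnergyBiddingGame

/-! By its position in the order, a budget is an integer in `0, …, 2k+1`: `⊕` and `⊖` become
addition and subtraction, and holding the advantage becomes parity. One turn is determined: if the
energy is at least `step f` at a configuration, some action of Preserver guarantees `f` after the
turn (`exists_preserver_action`, for `f` antitone in the budget); otherwise some action of Consumer
guarantees that `f` is violated (`exists_consumer_action`). Hence `mu n` is the energy needed to
survive `n` turns. Below `muLim = sup mu n` Consumer wins within finitely many turns. Since the game
is finite, `step muLim ≤ muLim`, so from `muLim` upwards Preserver wins by maintaining it forever.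
This gives determinacy and the threshold property. Moreover, `muLim` is the least `f` with `step f ≤
f`. If its finite values left a gap of length `W` below one of them, lowering everything above the
gap by one would give a smaller such `f`. A pigeonhole count then bounds the finite values by the
trimming bound (`muLim_le_bound`), so trimming does not change `muLim`, and both iterations reach
it. -/

namespace StarNat

/-! ### Budget arithmetic through positions -/

theorem adv_eq_true_iff (B : StarNat) : B.adv = true ↔ B.code % 2 = 1 := by
  rcases B with ⟨x, _ | _⟩ <;> simp [code]

theorem code_oplus (A B : StarNat) : (A.oplus B).code = A.code + B.code := by
  rcases A with ⟨x, _ | _⟩ <;> rcases B with ⟨y, _ | _⟩ <;> simp [code, oplus] <;> omega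

theorem code_ominus {A B : StarNat} (h : B.code ≤ A.code) :
    (A.ominus B).code = A.code - B.code := by
  rcases A with ⟨x, _ | _⟩ <;> rcases B with ⟨y, _ | _⟩ <;> simp [code, ominus] at h ⊢ <;> omega

theorem code_succ (A : StarNat) : A.succ.code = A.code + 1 := by
  rcases A with ⟨x, _ | _⟩ <;> simp [code, succ]; omega

theorem code_trump (B b : StarNat) :
    (B.trump b).code = if B.code % 2 = 1 ∧ b.code % 2 = 0 then b.code else b.code + 1 := by
  have hB := B.adv_eq_true_iff
  have hb : b.adv = false ↔ b.code % 2 = 0 := by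
    rw [← Bool.not_eq_true, b.adv_eq_true_iff]; omega
  unfold trump
  simp only [hB, hb]
  split_ifs
  · rfl
  · exact code_succ b

theorem le_iff_code {A B : StarNat} : A ≤ B ↔ A.code ≤ B.code := Iff.rfl

theorem lt_iff_code {A B : StarNat} : A < B ↔ A.code < B.code := by
  rw [← not_le, le_iff_code, not_le]

theorem code_star (k : ℕ) : (⟨k, true⟩ : StarNat).code = 2 * k + 1 := rfl

theorem mem_legalBids {B b : StarNat} :
    b ∈ B.legalBids ↔ b.code ≤ B.code ∧ (b.code % 2 = 1 → B.code % 2 = 1) := by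
  simp only [legalBids, Set.mem_ofPred_eq, adv_eq_true_iff, le_iff_code]

/-- The element of `ℕ*` at a given position. -/
def ofCode (n : ℕ) : StarNat := ⟨n / 2, decide (n % 2 = 1)⟩

theorem code_ofCode (n : ℕ) : (ofCode n).code = n := by
  rcases Nat.mod_two_eq_zero_or_one n with h | h <;> simp [ofCode, code, h] <;> omega

end StarNat

namespace Budget

theorem code_le {k : ℕ} (B : Budget k) : B.1.code ≤ 2 * k + 1 := B.2

theorem code_of {k : ℕ} {B : StarNat} (h : B.code ≤ 2 * k + 1) :
    (Budget.of k B).1.code = B.code := by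
  have : B ≤ ⟨k, true⟩ := h
  simp [Budget.of, min_eq_left this]

/-- The position of a budget in `[k]`. -/
def toFin {k : ℕ} (B : Budget k) : Fin (2 * (k + 1)) := ⟨B.1.code, by have := B.code_le; omega⟩

theorem toFin_injective {k : ℕ} : Function.Injective (toFin (k := k)) := fun _ _ h =>
  Subtype.ext (StarNat.code_injective (congrArg Fin.val h))

instance (k : ℕ) : Finite (Budget k) := Finite.of_injective _ toFin_injective

end Budget

/-! ### Sufficient energy and the value-iteration operator -/

namespace EnergyBiddingGame

variable {V : Type*} (G : EnergyBiddingGame V)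

/-- The energy `E` is at least the (finite) requirement that `f` puts on the configuration `c`. -/
def Suffices (f : V → Budget G.k → ℕ∞) (c : G.Config) (E : ℤ) : Prop :=
  ∃ n : ℕ, f c.1 c.2 = n ∧ (n : ℤ) ≤ E

variable {G}

theorem Suffices.nonneg {f : V → Budget G.k → ℕ∞} {c : G.Config} {E : ℤ}
    (h : G.Suffices f c E) : 0 ≤ E := by
  obtain ⟨n, -, hn⟩ := h
  omega

theorem suffices_iff_le {f : V → Budget G.k → ℕ∞} {c : G.Config} {M : ℕ} :
    G.Suffices f c M ↔ f c.1 c.2 ≤ M := by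
  constructor
  · rintro ⟨n, hn, h⟩
    rw [hn]
    exact_mod_cast h
  · intro h
    obtain ⟨n, hn⟩ := ENat.ne_top_iff_exists.1 (ne_top_of_le_ne_top (ENat.natCast_ne_top M) h)
    refine ⟨n, hn.symm, ?_⟩
    rw [← hn] at h
    exact_mod_cast h

theorem Suffices.mono {f g : V → Budget G.k → ℕ∞} {c d : G.Config} {E F : ℤ}
    (h : G.Suffices f c E) (hfg : g d.1 d.2 ≤ f c.1 c.2) (hEF : E ≤ F) : G.Suffices g d F := by
  have hE : E = (E.toNat : ℕ) := (Int.toNat_of_nonneg h.nonneg).symm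
  have hF : F = (F.toNat : ℕ) := (Int.toNat_of_nonneg (h.nonneg.trans hEF)).symm
  rw [hF, suffices_iff_le]
  rw [hE, suffices_iff_le] at h
  exact (hfg.trans h).trans (by exact_mod_cast Int.toNat_le_toNat hEF)

theorem deduct_le_iff {f : V → Budget G.k → ℕ∞} {u : V} {B : Budget G.k} {w : ℤ} {M : ℕ} :
    deduct (f u B) w ≤ M ↔ G.Suffices f (u, B) (M + w) := by
  unfold Suffices
  dsimp only
  cases hf : f u B with
  | top =>
    refine iff_of_false (fun h => ENat.natCast_ne_top M (top_le_iff.1 h)) ?_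
    rintro ⟨n, hn, -⟩
    exact ENat.top_ne_natCast n hn
  | coe x =>
    have : deduct (x : ℕ∞) w = ((max ((x : ℤ) - w) 0).toNat : ℕ) := rfl
    rw [this, Nat.cast_le]
    constructor
    · intro h
      exact ⟨x, rfl, by omega⟩
    · rintro ⟨n, hn, h⟩
      have : x = n := by exact_mod_cast hn
      omega

/-- Infima in `ℕ∞` are attained unless the index set is empty, and then the infimum is `⊤`, above
every natural number. -/
theorem iInf_mem_le_coe_iff {ι : Type*} {s : Set ι} {g : ι → ℕ∞} {M : ℕ} :
    ⨅ i ∈ s, g i ≤ (M : ℕ∞) ↔ ∃ i ∈ s, g i ≤ M := by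
  constructor
  · intro h
    by_contra! hc
    have : ((M : ℕ∞) + 1) ≤ ⨅ i ∈ s, g i :=
      le_iInf₂ fun i hi => Order.add_one_le_of_lt (hc i hi)
    have h2 := this.trans h
    exact absurd h2 (by exact_mod_cast Nat.not_succ_le_self M)
  · rintro ⟨i, hi, h⟩
    exact (iInf₂_le i hi).trans h

/-- With the requirement `f` on the next configuration, the energy `E` is enough if Preserver
bids `b`. -/
def GoodBid (f : V → Budget G.k → ℕ∞) (v : V) (B b : StarNat) (E : ℤ) : Prop :=
  (∃ u ∈ G.nbr v, G.Suffices f (u, Budget.of G.k (B.ominus b)) (E + G.w v u)) ∧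
  (B.code + (B.trump b).code ≤ 2 * G.k + 1 →
    ∀ u ∈ G.nbr v, G.Suffices f (u, Budget.of G.k (B.oplus (B.trump b))) (E + G.w v u))

theorem eNext_le_iff {f : V → Budget G.k → ℕ∞} {v : V} {B b : StarNat} {M : ℕ} :
    G.eNext f v B b ≤ M ↔ GoodBid f v B b M := by
  have hW : G.eWin f v B b ≤ M ↔
      ∃ u ∈ G.nbr v, G.Suffices f (u, Budget.of G.k (B.ominus b)) (M + G.w v u) := by
    simp only [eWin, iInf_mem_le_coe_iff, deduct_le_iff]
  have hL : G.eLose f v B b ≤ M ↔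
      ∀ u ∈ G.nbr v, G.Suffices f (u, Budget.of G.k (B.oplus (B.trump b))) (M + G.w v u) := by
    simp only [eLose, iSup_le_iff, deduct_le_iff]
  unfold eNext GoodBid
  split_ifs with h <;> rw [StarNat.le_iff_code, StarNat.code_oplus, StarNat.code_star] at h
  · rw [max_le_iff, hW, hL]
    simp [h]
  · rw [hW]
    simp [h]

theorem step_le_iff {f : V → Budget G.k → ℕ∞} {v : V} {B : Budget G.k} {M : ℕ} :
    G.step f v B ≤ M ↔ ∃ b ∈ B.1.legalBids, GoodBid f v B.1 b M := by
  simp only [step, iInf_mem_le_coe_iff, eNext_le_iff]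

/-- Reduces inequalities between extended values to finite bounds, where `step_le_iff` applies. -/
theorem le_of_forall_coe {x y : ℕ∞} (h : ∀ M : ℕ, y ≤ M → x ≤ M) : x ≤ y := by
  cases y with
  | top => exact le_top
  | coe n => exact h n le_rfl

theorem step_mono : Monotone G.step := by
  intro f g hfg v B
  refine le_of_forall_coe fun M hM => ?_
  rw [step_le_iff] at hM ⊢
  obtain ⟨b, hb, ⟨u, hu, hw⟩, hl⟩ := hM
  exact ⟨b, hb, ⟨u, hu, hw.mono (hfg _ _) le_rfl⟩,
    fun h u hu => (hl h u hu).mono (hfg _ _) le_rfl⟩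

/-- A requirement that does not increase with the budget of Preserver. -/
def BudgetAntitone (f : V → Budget G.k → ℕ∞) : Prop :=
  ∀ v (B C : Budget G.k), B.1.code ≤ C.1.code → f v C ≤ f v B

/-- Whoever wins the bidding, Preserver ends with at least as much budget as before, and any
trumping bid Consumer can still afford was affordable before. -/
theorem GoodBid.raise {f : V → Budget G.k → ℕ∞} (hf : BudgetAntitone f) {v : V}
    {B C : Budget G.k} {b c : StarNat} {E : ℤ} (h : GoodBid f v B.1 b E)
    (hb : b.code ≤ B.1.code) (hc : c.code ≤ C.1.code)
    (hwin : B.1.code - b.code ≤ C.1.code - c.code)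
    (hlose : B.1.code + (B.1.trump b).code ≤ C.1.code + (C.1.trump c).code) :
    GoodBid f v C.1 c E := by
  have hB := B.code_le
  have hC := C.code_le
  obtain ⟨⟨u, hu, hw⟩, hl⟩ := h
  refine ⟨⟨u, hu, hw.mono (hf _ _ _ ?_) le_rfl⟩, fun hk u hu =>
    (hl (hlose.trans hk) u hu).mono (hf _ _ _ ?_) le_rfl⟩
  · rw [Budget.code_of, Budget.code_of, StarNat.code_ominus hb, StarNat.code_ominus hc] <;>
      (try rw [StarNat.code_ominus hb]) <;> (try rw [StarNat.code_ominus hc]) <;> omega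
  · rw [Budget.code_of, Budget.code_of, StarNat.code_oplus, StarNat.code_oplus] <;>
      (try rw [StarNat.code_oplus]) <;> omega

theorem BudgetAntitone.step {f : V → Budget G.k → ℕ∞} (hf : BudgetAntitone f) :
    BudgetAntitone (G.step f) := by
  have one_more : ∀ v (B C : Budget G.k), C.1.code = B.1.code + 1 →
      G.step f v C ≤ G.step f v B := by
    intro v B C hBC
    refine le_of_forall_coe fun M hM => ?_
    rw [step_le_iff] at hM ⊢
    obtain ⟨b, hb, hgood⟩ := hM
    rw [StarNat.mem_legalBids] at hb
    -- The same bid without the advantage: moving up one position flips the parity, so an odd bid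
    -- stops being legal. The extra unit of budget makes up for the possible change in the trumping
    -- bid.
    obtain ⟨c, hc⟩ : ∃ c : StarNat, c.code = b.code - b.code % 2 :=
      ⟨StarNat.ofCode _, StarNat.code_ofCode _⟩
    refine ⟨c, ?_, hgood.raise hf hb.1 ?_ ?_ ?_⟩
    · rw [StarNat.mem_legalBids]
      omega
    · omega
    · omega
    · rw [StarNat.code_trump, StarNat.code_trump]
      split_ifs <;> omega
  intro v B C h
  obtain ⟨d, hd⟩ := Nat.exists_eq_add_of_le h
  induction d generalizing C with
  | zero =>
    have : C = B := Subtype.ext (StarNat.code_injective (by simpa using hd))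
    rw [this]
  | succ d ih =>
    have hC := C.code_le
    have hD : (Budget.of G.k (StarNat.ofCode (B.1.code + d))).1.code = B.1.code + d := by
      rw [Budget.code_of, StarNat.code_ofCode]
      rw [StarNat.code_ofCode]
      omega
    exact (one_more v _ C (by rw [hD]; omega)).trans (ih _ (by omega) hD)

/-! ### Determinacy of a single turn -/

theorem code_budgetOf_two (c : G.Config) :
    (G.budgetOf c .two).code = 2 * G.k + 1 - c.2.1.code := by
  have := c.2.code_le
  exact StarNat.code_ominus this

theorem firstWinsBid_iff {c : G.Config} {b₁ b₂ : StarNat} :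
    G.FirstWinsBid c b₁ b₂ ↔
      b₂.code < b₁.code ∨ (b₁.code = b₂.code ∧ c.2.1.code % 2 = 0) := by
  unfold FirstWinsBid
  rw [StarNat.lt_iff_code, StarNat.code_injective.eq_iff, ← Bool.not_eq_true,
    StarNat.adv_eq_true_iff, Nat.mod_two_not_eq_one]

/-- Preserver can ensure in one turn that the requirement `f` is met. -/
theorem exists_preserver_action {f : V → Budget G.k → ℕ∞} (hf : BudgetAntitone f)
    {c : G.Config} {M : ℕ} (h : G.step f c.1 c.2 ≤ M) :
    ∃ a₁ ∈ G.arena.allowed c .one, ∀ a₂ ∈ G.arena.allowed c .two,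
      G.Suffices f (G.arena.δ c a₁ a₂) (M + G.w c.1 (G.arena.δ c a₁ a₂).1) := by
  obtain ⟨b, hb, ⟨u, hu, hw⟩, hl⟩ := step_le_iff.1 h
  have hB := c.2.code_le
  refine ⟨(⟨b, hb.1.trans c.2.2⟩, u), ⟨hb, hu⟩, fun a₂ ha₂ => ?_⟩
  obtain ⟨hleg, hu₂⟩ := ha₂
  rw [StarNat.mem_legalBids, code_budgetOf_two] at hleg
  rw [StarNat.mem_legalBids] at hb
  simp only [arena]
  split_ifs with hwin
  · exact hw
  · rw [firstWinsBid_iff] at hwin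
    -- Consumer pays at least the trumping bid, since the players' budgets have opposite parity;
    -- overpaying only helps Preserver, as `f` is antitone.
    have htrump : (c.2.1.trump b).code ≤ a₂.1.1.code := by
      rw [StarNat.code_trump]
      split_ifs <;> omega
    refine (hl (by omega) _ hu₂).mono (hf _ _ _ ?_) le_rfl
    rw [Budget.code_of, Budget.code_of, StarNat.code_oplus, StarNat.code_oplus] <;>
      (try rw [StarNat.code_oplus]) <;> omega

/-- Consumer can ensure in one turn that the requirement `f` is violated. -/
theorem exists_consumer_action {f : V → Budget G.k → ℕ∞}
    {c : G.Config} {M : ℕ} (h : ¬ G.step f c.1 c.2 ≤ M) :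
    ∃ a₂ ∈ G.arena.allowed c .two, ∀ a₁ ∈ G.arena.allowed c .one,
      ¬ G.Suffices f (G.arena.δ c a₁ a₂) (M + G.w c.1 (G.arena.δ c a₁ a₂).1) := by
  rw [step_le_iff] at h
  push Not at h
  have hB := c.2.code_le
  let Aff (b : StarNat) : Prop :=
    ∃ u ∈ G.nbr c.1, G.Suffices f (u, Budget.of G.k (c.2.1.ominus b)) (M + G.w c.1 u)
  -- it is enough to find a bid and a vertex that are good upon winning and force overpaying
  have key : ∀ (t : Budget G.k) (u : V), u ∈ G.nbr c.1 →
      t.1 ∈ (G.budgetOf c .two).legalBids →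
      (∀ b ∈ c.2.1.legalBids, G.FirstWinsBid c b t.1 → ¬ Aff b) →
      ((∃ b ∈ c.2.1.legalBids, ¬ G.FirstWinsBid c b t.1) →
        ¬ G.Suffices f (u, Budget.of G.k (c.2.1.oplus t.1)) (M + G.w c.1 u)) →
      ∃ a₂ ∈ G.arena.allowed c .two, ∀ a₁ ∈ G.arena.allowed c .one,
        ¬ G.Suffices f (G.arena.δ c a₁ a₂) (M + G.w c.1 (G.arena.δ c a₁ a₂).1) := by
    intro t u hu ht hwin hlose
    refine ⟨(t, u), ⟨ht, hu⟩, fun a₁ ha₁ => ?_⟩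
    obtain ⟨hb, hu₁⟩ := ha₁
    simp only [arena]
    split_ifs with hfirst
    · exact fun hs => hwin _ hb hfirst ⟨_, hu₁, hs⟩
    · exact hlose ⟨_, hb, hfirst⟩
  by_cases haff : ∃ n, ∃ b ∈ c.2.1.legalBids, Aff b ∧ b.code = n
  -- Consumer trumps the highest bid that Preserver could afford to win with. Any bid beating this
  -- is higher still, hence not affordable; if Consumer wins, the failure of `GoodBid` at `b`
  -- supplies the bad neighbor.
  · obtain ⟨b, hb, hab, hmax⟩ : ∃ b ∈ c.2.1.legalBids, Aff b ∧
        ∀ b' ∈ c.2.1.legalBids, Aff b' → b'.code ≤ b.code := by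
      classical
      obtain ⟨n, b, hb, hab, hbn⟩ := haff
      let P : ℕ → Prop := fun n => ∃ b ∈ c.2.1.legalBids, Aff b ∧ b.code = n
      have hle : ∀ b ∈ c.2.1.legalBids, b.code ≤ 2 * G.k + 1 := fun b hb =>
        (StarNat.mem_legalBids.1 hb).1.trans hB
      have hspec : P (Nat.findGreatest P (2 * G.k + 1)) :=
        Nat.findGreatest_spec (hle b hb) ⟨b, hb, hab, rfl⟩
      obtain ⟨d, hd, had, hdn⟩ := hspec
      refine ⟨d, hd, had, fun b' hb' hab' => ?_⟩
      rw [hdn]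
      exact Nat.le_findGreatest (hle b' hb') ⟨b', hb', hab', rfl⟩
    have hbad := h b hb
    unfold GoodBid at hbad
    push Not at hbad
    obtain ⟨hk, u, hu, hs⟩ := hbad hab
    rw [StarNat.mem_legalBids] at hb
    have htr := StarNat.code_trump c.2.1 b
    have htk : (c.2.1.trump b).code ≤ 2 * G.k + 1 := by omega
    refine key ⟨c.2.1.trump b, htk⟩ u hu ?_ ?_ (fun _ => hs)
    · rw [StarNat.mem_legalBids, code_budgetOf_two]
      dsimp only
      split_ifs at htr <;> omega
    · intro b' hb' hwin hab'
      have := hmax b' hb' hab'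
      rw [firstWinsBid_iff] at hwin
      rw [StarNat.mem_legalBids] at hb'
      dsimp only at hwin
      split_ifs at htr <;> omega
  -- Preserver cannot afford to win with any bid, so Consumer bids `0`: if it wins, the budget is
  -- the same as after Preserver wins with `0`, which is not affordable either.
  · push Not at haff
    obtain ⟨u, hu⟩ := G.exists_edge c.1
    have h0 : (⟨0, false⟩ : StarNat).code = 0 := rfl
    have hmem : ∀ B : StarNat, ⟨0, false⟩ ∈ B.legalBids := fun B => by
      rw [StarNat.mem_legalBids, h0]; omega
    refine key ⟨⟨0, false⟩, Nat.zero_le _⟩ u hu (hmem _)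
      (fun b hb _ hab => haff _ b hb hab rfl) (fun _ hs => ?_)
    refine haff _ ⟨0, false⟩ (hmem _) ⟨u, hu, ?_⟩ rfl
    have h1 : c.2.1.oplus ⟨0, false⟩ = c.2.1.ominus ⟨0, false⟩ :=
      StarNat.code_injective (by rw [StarNat.code_oplus, StarNat.code_ominus] <;> rw [h0] <;> omega)
    rwa [← h1]

/-! ### Winning strategies -/

theorem sumOfWeights_succ (π : ℕ → V) (m : ℕ) :
    G.sumOfWeights π (m + 1) = G.sumOfWeights π m + G.w (π m) (π (m + 1)) :=
  Finset.sum_range_succ _ _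

/-- The action is chosen for the exact requirement `f q`; any surplus energy is carried along, so a
memoryless strategy suffices. -/
theorem presWins_of_step_le {f : V → Budget G.k → ℕ∞} (hf : BudgetAntitone f)
    (hstep : G.step f ≤ f) {c : G.Config} {E : ℤ} (h : G.Suffices f c E) : G.PresWins E c := by
  have key : ∀ q : G.Config, ∃ a₁ ∈ G.arena.allowed q .one, ∀ a₂ ∈ G.arena.allowed q .two,
      ∀ F, G.Suffices f q F →
        G.Suffices f (G.arena.δ q a₁ a₂) (F + G.w q.1 (G.arena.δ q a₁ a₂).1) := by
    intro q
    cases hq : f q.1 q.2 with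
    | top =>
      obtain ⟨a, ha⟩ := G.arena.allowed_nonempty q .one
      refine ⟨a, ha, fun _ _ F ⟨n, hn, _⟩ => ?_⟩
      rw [hq] at hn
      exact absurd hn (ENat.top_ne_natCast n)
    | coe n =>
      obtain ⟨a, ha, H⟩ := exists_preserver_action (c := q) (M := n) hf
        ((hstep q.1 q.2).trans hq.le)
      refine ⟨a, ha, fun a₂ ha₂ F ⟨m, hm, hF⟩ => (H a₂ ha₂).mono le_rfl ?_⟩
      have : n = m := by exact_mod_cast hq.symm.trans hm
      omega
  choose a ha H using key
  refine ⟨⟨fun _ q => a q, fun _ q => ha q⟩, fun τ m => ?_⟩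
  refine Suffices.nonneg (f := f) (c := G.arena.play c ⟨fun _ q => a q, fun _ q => ha q⟩ τ m) ?_
  induction m with
  | zero =>
    rw [show G.sumOfWeights _ 0 = 0 from rfl, add_zero]
    exact h
  | succ m ih =>
    rw [sumOfWeights_succ, ← add_assoc]
    exact H _ _ (τ.2 _ _) _ ih

variable (G) in
/-- The sum of the weights along a finite sequence of configurations. -/
def historyWeight : List G.Config → ℤ
  | [] => 0
  | [_] => 0
  | a :: b :: l => G.w a.1 b.1 + historyWeight (b :: l)

theorem historyWeight_concat (l : List G.Config) (a b : G.Config) :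
    G.historyWeight (l ++ [a] ++ [b]) = G.historyWeight (l ++ [a]) + G.w a.1 b.1 := by
  induction l with
  | nil => simp [historyWeight]
  | cons x l ih =>
    cases l with
    | nil => simp [historyWeight]
    | cons y l =>
      simp only [List.cons_append, historyWeight] at ih ⊢
      rw [ih, add_assoc]

theorem length_run (c : G.Config) (σ : G.arena.Strategy .one) (τ : G.arena.Strategy .two) (n : ℕ) :
    (G.arena.run c σ τ n).1.length = n := by
  induction n with
  | zero => rfl
  | succ n ih => simp [ConcurrentArena.run, ih]

theorem historyWeight_run (c : G.Config) (σ : G.arena.Strategy .one) (τ : G.arena.Strategy .two)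
    (n : ℕ) : G.historyWeight ((G.arena.run c σ τ n).1 ++ [(G.arena.run c σ τ n).2]) =
      G.sumOfWeights (G.path c σ τ) n := by
  induction n with
  | zero => rfl
  | succ n ih =>
    rw [sumOfWeights_succ, ← ih]
    exact historyWeight_concat _ _ _

theorem budgetAntitone_mu (n : ℕ) : BudgetAntitone (G.mu n) := by
  induction n with
  | zero => exact fun _ _ _ _ => le_rfl
  | succ n ih => exact ih.step

/-- As long as the energy is nonnegative, Consumer keeps it insufficient for `mu` of the number of
turns left; when none are left, insufficient for `mu 0 = 0` means negative. -/
theorem consWins_of_not_suffices_mu {n : ℕ} {c : G.Config} {E : ℤ}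
    (h : ¬ G.Suffices (G.mu n) c E) : G.ConsWins E c := by
  have key : ∀ (i : ℕ) (F : ℤ) (q : G.Config), ∃ a₂ ∈ G.arena.allowed q .two,
      0 ≤ F → ¬ G.Suffices (G.mu (i + 1)) q F → ∀ a₁ ∈ G.arena.allowed q .one,
        ¬ G.Suffices (G.mu i) (G.arena.δ q a₁ a₂) (F + G.w q.1 (G.arena.δ q a₁ a₂).1) := by
    intro i F q
    by_cases hF : 0 ≤ F ∧ ¬ G.Suffices (G.mu (i + 1)) q F
    · obtain ⟨M, rfl⟩ := Int.eq_ofNat_of_zero_le hF.1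
      obtain ⟨a, ha, H⟩ := exists_consumer_action (c := q) (M := M)
        (fun hs => hF.2 (suffices_iff_le.2 hs))
      exact ⟨a, ha, fun _ _ => H⟩
    · obtain ⟨a, ha⟩ := G.arena.allowed_nonempty q .two
      exact ⟨a, ha, fun h1 h2 => absurd ⟨h1, h2⟩ hF⟩
  choose a ha H using key
  let τ : G.arena.Strategy .two :=
    -- Index `i` of `a` passes from `mu (i + 1)` to `mu i`, hence the `- 1`. The truncated value
    -- after `n` turns plays no role.
    ⟨fun hist q => a (n - hist.length - 1) (E + G.historyWeight (hist ++ [q])) q,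
      fun hist q => ha _ _ q⟩
  refine ⟨τ, fun σ => ?_⟩
  by_contra hcon
  have hnonneg : ∀ m, 0 ≤ E + G.sumOfWeights (G.path c σ τ) m := by
    simpa [ConsWinsPath] using hcon
  have inv : ∀ j ≤ n, ¬ G.Suffices (G.mu (n - j)) (G.arena.play c σ τ j)
      (E + G.sumOfWeights (G.path c σ τ) j) := by
    intro j
    induction j with
    | zero =>
      intro _
      rw [show G.sumOfWeights _ 0 = 0 from rfl, add_zero]
      exact h
    | succ j ih =>
      intro hj
      have hi : n - j = n - (j + 1) + 1 := by omega
      have h1 := ih (by omega)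
      rw [hi] at h1
      have h2 := H _ _ _ (hnonneg j) h1 _ (σ.2 (G.arena.run c σ τ j).1 _)
      rw [sumOfWeights_succ, ← add_assoc]
      have h3 : τ.1 (G.arena.run c σ τ j).1 (G.arena.run c σ τ j).2 =
          a (n - (j + 1)) (E + G.sumOfWeights (G.path c σ τ) j) (G.arena.play c σ τ j) := by
        change a _ _ _ = _
        rw [length_run, historyWeight_run, Nat.sub_sub]
        rfl
      rw [← h3] at h2
      exact h2
  refine inv n le_rfl ⟨0, ?_, by simpa using hnonneg n⟩
  rw [Nat.sub_self]
  rfl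

theorem PresWins.not_consWins {c : G.Config} {E : ℤ} (h : G.PresWins E c) : ¬ G.ConsWins E c := by
  rintro ⟨τ, hτ⟩
  obtain ⟨σ, hσ⟩ := h
  obtain ⟨m, hm⟩ := hτ σ
  exact absurd (hσ τ m) (not_le.2 hm)

/-! ### The limit of value iteration -/

theorem mu_monotone : Monotone G.mu := by
  refine monotone_nat_of_le_succ fun n => ?_
  induction n with
  | zero => exact fun _ _ => zero_le
  | succ n ih => exact step_mono ih

theorem mu_le_of_step_le {f : V → Budget G.k → ℕ∞} (h : G.step f ≤ f) (n : ℕ) : G.mu n ≤ f := by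
  induction n with
  | zero => exact fun _ _ => zero_le
  | succ n ih => exact (step_mono ih).trans h

variable (G) in
/-- The pointwise limit of the functions `μ_n`. -/
noncomputable def muLim (v : V) (B : Budget G.k) : ℕ∞ := ⨆ n, G.mu n v B

theorem mu_le_muLim (n : ℕ) : G.mu n ≤ G.muLim := fun v B => le_iSup (fun n => G.mu n v B) n

theorem budgetAntitone_muLim : BudgetAntitone G.muLim := fun v B C h =>
  iSup_mono fun n => budgetAntitone_mu n v B C h

theorem eventually_mu_eq_or_gt (T : ℕ) (v : V) (B : Budget G.k) :
    ∃ N, ∀ n ≥ N, G.mu n v B = G.muLim v B ∨ (G.muLim v B = ⊤ ∧ (T : ℕ∞) < G.mu n v B) := by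
  cases h : G.muLim v B with
  | top =>
    have : (T : ℕ∞) < ⨆ n, G.mu n v B := by
      change (T : ℕ∞) < G.muLim v B
      rw [h]; exact ENat.natCast_lt_top T
    obtain ⟨N, hN⟩ := lt_iSup_iff.1 this
    exact ⟨N, fun n hn => Or.inr ⟨rfl, hN.trans_le (mu_monotone hn v B)⟩⟩
  | coe x =>
    obtain ⟨N, hN⟩ : ∃ N, (x : ℕ∞) ≤ G.mu N v B := by
      by_contra! hc
      cases x with
      | zero => exact absurd (hc 0) (by simp)
      | succ x =>
        have : G.muLim v B ≤ x := iSup_le fun n => by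
          have := hc n
          push_cast at this
          exact Order.le_of_lt_add_one this
        rw [h] at this
        exact absurd this (by exact_mod_cast Nat.not_succ_le_self x)
    refine ⟨N, fun n hn => Or.inl (le_antisymm ?_ (hN.trans (mu_monotone hn v B)))⟩
    rw [← h]
    exact mu_le_muLim n v B

theorem eventually_forall_mu_eq_or_gt [Finite V] (T : ℕ) :
    ∃ N, ∀ n ≥ N, ∀ v B,
      G.mu n v B = G.muLim v B ∨ (G.muLim v B = ⊤ ∧ (T : ℕ∞) < G.mu n v B) := by
  choose N hN using fun c : G.Config => eventually_mu_eq_or_gt T c.1 c.2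
  obtain ⟨b, hb⟩ := (Set.finite_range N).bddAbove
  exact ⟨b, fun n hn v B => hN (v, B) n ((hb ⟨(v, B), rfl⟩).trans hn)⟩

theorem natAbs_w_le_W [Fintype V] {v u : V} (h : u ∈ G.nbr v) : (G.w v u).natAbs ≤ G.W := by
  classical
  exact Finset.le_sup (s := Finset.univ.filter fun e : V × V => G.edge e.1 e.2)
    (f := fun e : V × V => (G.w e.1 e.2).natAbs) (b := (v, u))
    (Finset.mem_filter.2 ⟨Finset.mem_univ _, h⟩)

theorem step_muLim_le [Fintype V] : G.step G.muLim ≤ G.muLim := by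
  intro v B
  refine le_of_forall_coe fun M hM => ?_
  -- A successor requirement met with energy at most `M + W` is then already equal to its limit, so
  -- a good bid for `mu n` is good for `muLim`.
  obtain ⟨n, hn⟩ := eventually_forall_mu_eq_or_gt (G := G) (M + G.W)
  have hstep : G.step (G.mu n) v B ≤ M := (mu_le_muLim (n + 1) v B).trans hM
  rw [step_le_iff] at hstep ⊢
  have lift : ∀ u ∈ G.nbr v, ∀ C, G.Suffices (G.mu n) (u, C) (M + G.w v u) →
      G.Suffices G.muLim (u, C) (M + G.w v u) := by
    rintro u hu C ⟨x, hx, hxE⟩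
    rcases hn n le_rfl u C with h | ⟨-, h⟩
    · exact ⟨x, h.symm.trans hx, hxE⟩
    · rw [show G.mu n u C = x from hx] at h
      have h' : M + G.W < x := by exact_mod_cast h
      have := natAbs_w_le_W hu
      omega
  obtain ⟨b, hb, ⟨u, hu, hw⟩, hl⟩ := hstep
  exact ⟨b, hb, ⟨u, hu, lift u hu _ hw⟩, fun h u hu => lift u hu _ (hl h u hu)⟩

theorem muLim_le_of_step_le {f : V → Budget G.k → ℕ∞} (h : G.step f ≤ f) : G.muLim ≤ f :=
  fun v B => iSup_le fun n => mu_le_of_step_le h n v B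

/-- The finite values of the limit have no gap of length `W` below any of them. -/
theorem exists_muLim_mem_Ioc [Fintype V] {v₀ : V} {B₀ : Budget G.k} {x₀ L : ℕ}
    (hx₀ : G.muLim v₀ B₀ = x₀) (hL : L + G.W < x₀) :
    ∃ v B, ∃ x : ℕ, G.muLim v B = x ∧ L < x ∧ x ≤ L + G.W := by
  classical
  by_contra! hgap
  -- Values above `L` exceed `L + W`, so after one edge an energy lowered by one is still at least
  -- `L`: it covers the unchanged requirements, and the others drop by one as well.
  let g : V → Budget G.k → ℕ∞ := fun v B =>
    if G.muLim v B ≤ L then G.muLim v B else G.muLim v B - 1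
  have hg : g ≤ G.muLim := fun v B => by
    dsimp only [g]
    split_ifs
    · exact le_rfl
    · exact tsub_le_self
  have hpre : G.step g ≤ g := by
    intro v B
    by_cases hlow : G.muLim v B ≤ L
    · have : g v B = G.muLim v B := if_pos hlow
      rw [this]
      exact (step_mono hg v B).trans (step_muLim_le v B)
    · cases hx : G.muLim v B with
      | top =>
        have : g v B = ⊤ := by
          change ite _ _ _ = _
          rw [if_neg hlow, hx]
          rfl
        rw [this]
        exact le_top
      | coe x =>
        have hLx : L < x := by
          rw [hx] at hlow
          exact_mod_cast not_le.1 hlow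
        have hbig := hgap v B x hx hLx
        have hgv : g v B = ((x - 1 : ℕ) : ℕ∞) := by
          change ite _ _ _ = _
          rw [if_neg hlow, hx]
          norm_cast
        rw [hgv, step_le_iff]
        have lower : ∀ u ∈ G.nbr v, ∀ C, G.Suffices G.muLim (u, C) (x + G.w v u) →
            G.Suffices g (u, C) ((x - 1 : ℕ) + G.w v u) := by
          rintro u hu C ⟨y, hy, hyE⟩
          change G.muLim u C = y at hy
          have hW := natAbs_w_le_W hu
          by_cases hyL : y ≤ L
          · refine ⟨y, ?_, by omega⟩
            change ite _ _ _ = _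
            rw [if_pos (by rw [hy]; exact_mod_cast hyL), hy]
          · refine ⟨y - 1, ?_, by omega⟩
            change ite _ _ _ = _
            rw [if_neg (by rw [hy]; exact_mod_cast hyL), hy]
            norm_cast
        obtain ⟨b, hb, ⟨u, hu, hw⟩, hl⟩ := step_le_iff.1 ((step_muLim_le v B).trans hx.le)
        exact ⟨b, hb, ⟨u, hu, lower u hu _ hw⟩, fun h u hu => lower u hu _ (hl h u hu)⟩
  have h1 := muLim_le_of_step_le hpre v₀ B₀
  have h2 : g v₀ B₀ = ((x₀ - 1 : ℕ) : ℕ∞) := by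
    change ite _ _ _ = _
    rw [if_neg, hx₀]
    · norm_cast
    · rw [hx₀, Nat.cast_le]
      omega
  rw [hx₀, h2] at h1
  have : x₀ ≤ x₀ - 1 := Nat.cast_le.1 h1
  omega

/-- A value above `K * W` forces one in each interval `(jW, (j+1)W]` with `j < K`; together with
`x₀`, at `none`, these are `K + 1` distinct values on at most `K` configurations. -/
theorem muLim_le_bound [Fintype V] {v₀ : V} {B₀ : Budget G.k} {x₀ : ℕ}
    (hx₀ : G.muLim v₀ B₀ = x₀) : x₀ ≤ Fintype.card V * (2 * (G.k + 1)) * G.W := by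
  by_contra! hlt
  set K := Fintype.card V * (2 * (G.k + 1)) with hK
  have key : ∀ j : Fin K, ∃ c : G.Config, ∃ x : ℕ, G.muLim c.1 c.2 = x ∧
      j * G.W < x ∧ x ≤ (j + 1) * G.W := by
    intro j
    have h1 : ((j : ℕ) + 1) * G.W ≤ K * G.W := Nat.mul_le_mul_right _ j.2
    rw [Nat.add_one_mul] at h1 ⊢
    obtain ⟨v, B, x, hx⟩ := exists_muLim_mem_Ioc hx₀ (L := j * G.W) (by omega)
    exact ⟨(v, B), x, hx⟩
  choose c x hx hlo hhi using key
  have hval : ∀ i j : Fin K, i < j → x i < x j := fun i j hij =>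
    (hhi i).trans_lt ((Nat.mul_le_mul_right _ hij).trans_lt (hlo j))
  let F : Option (Fin K) → V × Fin (2 * (G.k + 1)) := fun o =>
    Prod.map id Budget.toFin (o.elim ((v₀, B₀) : G.Config) c)
  have hx_lt : ∀ i, x i < x₀ := fun i =>
    (hhi i).trans_lt ((Nat.mul_le_mul_right _ i.2).trans_lt hlt)
  have hF : Function.Injective F := by
    refine (Function.injective_id.prodMap Budget.toFin_injective).comp ?_
    have hcx : ∀ i j, c i = c j → x i = x j := fun i j h => by
      have := hx i
      rw [h, hx j] at this
      exact_mod_cast this.symm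
    have hc0 : ∀ i, c i ≠ (v₀, B₀) := fun i h => by
      have := hx i
      rw [h, hx₀] at this
      have h2 : x₀ = x i := by exact_mod_cast this
      exact absurd (hx_lt i) (by omega)
    rintro (_ | i) (_ | j) h
    · rfl
    · exact absurd h.symm (hc0 j)
    · exact absurd h (hc0 i)
    · rcases lt_trichotomy i j with hij | rfl | hij
      · exact absurd (hcx i j h) (hval i j hij).ne
      · rfl
      · exact absurd (hcx i j h) (hval j i hij).ne'
  have := Fintype.card_le_of_injective F hF
  simp only [Fintype.card_option, Fintype.card_prod, Fintype.card_fin] at this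
  omega

/-! ### The limit decides the winner -/

theorem suffices_muLim_iff_forall {c : G.Config} {E : ℤ} :
    G.Suffices G.muLim c E ↔ ∀ n, G.Suffices (G.mu n) c E := by
  refine ⟨fun h n => h.mono (mu_le_muLim n _ _) le_rfl, fun h => ?_⟩
  obtain ⟨M, rfl⟩ := Int.eq_ofNat_of_zero_le (h 0).nonneg
  exact suffices_iff_le.2 (iSup_le fun n => suffices_iff_le.1 (h n))

theorem consWins_of_not_suffices {c : G.Config} {E : ℤ} (h : ¬ G.Suffices G.muLim c E) :
    G.ConsWins E c := by
  rw [suffices_muLim_iff_forall] at h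
  push Not at h
  obtain ⟨n, hn⟩ := h
  exact consWins_of_not_suffices_mu hn

theorem presWins_iff [Fintype V] {c : G.Config} {E : ℤ} :
    G.PresWins E c ↔ G.Suffices G.muLim c E :=
  ⟨fun h => by_contra fun hs => h.not_consWins (consWins_of_not_suffices hs),
    presWins_of_step_le budgetAntitone_muLim step_muLim_le⟩

theorem consWins_iff [Fintype V] {c : G.Config} {E : ℤ} :
    G.ConsWins E c ↔ ¬ G.Suffices G.muLim c E :=
  ⟨fun h hs => (presWins_iff.2 hs).not_consWins h, consWins_of_not_suffices⟩

theorem isEnergyThreshold_iff [Fintype V] (e : V → Budget G.k → ℕ∞) :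
    G.IsEnergyThreshold e ↔ e = G.muLim := by
  simp only [IsEnergyThreshold, presWins_iff, consWins_iff]
  constructor
  · intro h
    funext v B
    obtain ⟨h1, h2⟩ := h v B
    cases he : e v B with
    | top =>
      cases hm : G.muLim v B with
      | top => rfl
      | coe n => exact absurd ⟨n, hm, le_rfl⟩ (h2 he n)
    | coe n =>
      obtain ⟨⟨m, hm, hmn⟩, h4⟩ := h1 n he
      change G.muLim v B = m at hm
      have : ¬ (m : ℤ) ≤ n - 1 := fun h => h4 ⟨m, hm, h⟩
      rw [hm]
      congr 1
      omega
  · rintro rfl v B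
    refine ⟨fun M hM => ⟨⟨M, hM, le_rfl⟩, ?_⟩, ?_⟩
    · rintro ⟨n, hn, hle⟩
      have : M = n := by exact_mod_cast hM.symm.trans hn
      omega
    · rintro htop M ⟨n, hn, -⟩
      exact ENat.top_ne_natCast n (htop.symm.trans hn)

/-! ### Trimming -/

theorem le_trim [Fintype V] (f : V → Budget G.k → ℕ∞) : f ≤ G.trim f := fun v B => by
  unfold trim
  split_ifs
  · exact le_rfl
  · exact le_top

theorem trim_mono [Fintype V] : Monotone G.trim := fun f g h v B => by
  unfold trim
  split_ifs with h1 h2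
  · exact h v B
  · exact le_top
  · exact absurd ((h v B).trans ‹_›) h1
  · exact le_rfl

theorem trim_muLim [Fintype V] : G.trim G.muLim = G.muLim := by
  funext v B
  unfold trim
  split_ifs with h
  · rfl
  · cases hx : G.muLim v B with
    | top => rfl
    | coe x =>
      rw [hx] at h
      exact absurd (Nat.cast_le.2 (muLim_le_bound hx)) h

theorem eventually_trimmedMu_eq [Fintype V] : ∃ N, ∀ n ≥ N, G.trimmedMu n = G.muLim := by
  obtain ⟨N, hN⟩ := eventually_forall_mu_eq_or_gt (G := G)
    (Fintype.card V * (2 * (G.k + 1)) * G.W)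
  refine ⟨N, fun n hn => ?_⟩
  rw [← trim_muLim]
  funext v B
  unfold trimmedMu trim
  rcases hN n hn v B with h | ⟨htop, hgt⟩
  · rw [h]
  · rw [if_neg (not_le.2 hgt), htop, ite_self]

theorem algMu_le_muLim [Fintype V] (i : ℕ) : G.algMu i ≤ G.muLim := by
  induction i with
  | zero => exact fun _ _ => zero_le
  | succ i ih =>
    calc G.algMu (i + 1) ≤ G.trim G.muLim := trim_mono ((step_mono ih).trans step_muLim_le)
      _ = G.muLim := trim_muLim

theorem mu_le_algMu [Fintype V] (i : ℕ) : G.mu i ≤ G.algMu i := by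
  induction i with
  | zero => exact le_rfl
  | succ i ih => exact (step_mono ih).trans (le_trim _)

/-- `algMu` is squeezed between `trimmedMu` and `muLim`. -/
theorem eventually_algMu_eq [Fintype V] : ∃ N, ∀ n ≥ N, G.algMu n = G.muLim := by
  obtain ⟨N, hN⟩ := eventually_trimmedMu_eq (G := G)
  refine ⟨N + 1, fun n hn => le_antisymm (algMu_le_muLim n) ?_⟩
  obtain ⟨m, rfl⟩ : ∃ m, n = m + 1 := ⟨n - 1, by omega⟩
  rw [← hN (m + 1) (by omega)]
  exact trim_mono (step_mono (mu_le_algMu m))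

/-- Trimming only raises values, so a stationary iterate `f` satisfies `step f ≤ f`, and leastness
of `muLim` applies. -/
theorem algMu_eq_of_stationary [Fintype V] {i : ℕ} (h : G.algMu (i + 1) = G.algMu i) :
    G.algMu (i + 1) = G.muLim := by
  refine le_antisymm (algMu_le_muLim _) (muLim_le_of_step_le ?_)
  calc G.step (G.algMu (i + 1)) = G.step (G.algMu i) := by rw [h]
    _ ≤ G.algMu (i + 1) := le_trim _

end EnergyBiddingGame

theorem mainTheorem1 {V : Type*} [Fintype V] (G : EnergyBiddingGame V) :
    ∃ μ : V → Budget G.k → ℕ∞,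
      -- `μ` is the function at which the trimmed value iteration becomes stationary
      (∃ N, ∀ n ≥ N, G.trimmedMu n = μ) ∧
      -- the algorithmic form of the iteration terminates, and returns `μ`
      ((∃ i, G.algMu (i + 1) = G.algMu i) ∧
        ∀ i, G.algMu (i + 1) = G.algMu i → G.algMu (i + 1) = μ) ∧
      -- the energy threshold function exists, is unique, and equals `μ`
      (∀ e : V → Budget G.k → ℕ∞, G.IsEnergyThreshold e ↔ e = μ) ∧
      -- who wins with which initial energy
      (∀ v B (M : ℕ),
        ((μ v B ≤ M → G.PresWins M (v, B)) ∧ ((M : ℕ∞) < μ v B → G.ConsWins M (v, B)))) ∧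
      G.Determined := by
  obtain ⟨N, hN⟩ := EnergyBiddingGame.eventually_algMu_eq (G := G)
  refine ⟨G.muLim, EnergyBiddingGame.eventually_trimmedMu_eq,
    ⟨⟨N, (hN (N + 1) (by omega)).trans (hN N le_rfl).symm⟩,
      fun i => EnergyBiddingGame.algMu_eq_of_stationary⟩,
    EnergyBiddingGame.isEnergyThreshold_iff, fun v B M => ⟨fun h => ?_, fun h => ?_⟩,
    fun c M => ?_⟩
  · exact EnergyBiddingGame.presWins_iff.2 (EnergyBiddingGame.suffices_iff_le.2 h)
  · exact EnergyBiddingGame.consWins_iff.2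
      fun hs => absurd h (not_lt.2 (EnergyBiddingGame.suffices_iff_le.1 hs))
  · rw [EnergyBiddingGame.presWins_iff, EnergyBiddingGame.consWins_iff]
    exact em _
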